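/- Formulas are built from a denumerable set of variables with the connectives $\&,\wedge,\to$ (binary) and $\bot$ (0-ary), and $\varphi\vee\psi$ abbreviates $((\varphi\to\psi)\to\psi)\wedge((\psi\to\varphi)\to\varphi)$. The monoidal t-norm based logic MTL has modus ponens as its only rule and the axiom schemata $(\varphi\to\psi)\to((\psi\to\chi)\to(\varphi\to\chi))$; $(\varphi\&\psi)\to\varphi$; $(\varphi\&\psi)\to(\psi\&\varphi)$; $(\varphi\wedge\psi)\to\varphi$; $(\varphi\wedge\psi)\to(\psi\wedge\varphi)$; $(\varphi\&(\varphi\to\psi))\to(\psi\wedge\varphi)$; $(\varphi\to(\psi\to\chi))\to((\varphi\&\psi)\to\chi)$; $((\varphi\&\psi)\to\chi)\to(\varphi\to(\psi\to\chi))$; $((\varphi\to\psi)\to\chi)\to(((\psi\to\varphi)\to\chi)\to\chi)$; $\bot\to\varphi$. An axiomatic extension of MTL is a logic obtained by adding a set of further axiom schemata; it is identified with its set of theorems. The axiomatic extensions of MTL, ordered by inclusion, form a lattice in which the meet is intersection. An MTL-algebra is an algebra $\langle A,*,\Rightarrow,\sqcap,\sqcup,0,1\rangle$ such that $\langle A,\sqcap,\sqcup,0,1\rangle$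 is a lattice with minimum $0$ and maximum $1$, $\langle A,*,1\rangle$ is a commutative monoid, $z*x\le y$ iff $z\le x\Rightarrow y$ for all $x,y,z\in A$, and $(x\Rightarrow y)\sqcup(y\Rightarrow x)=1$ for all $x,y\in A$. An MTL-chain is a totally ordered MTL-algebra (the one-element algebra is allowed). A formula is valid in $A$ if every assignment of elements of $A$ to the variables gives it the value $1$, where $\&,\wedge,\to,\bot$ are interpreted by $*,\sqcap,\Rightarrow,0$. **Theorem.** Let $L$ be an axiomatic extension of MTL. The following are equivalent. 1. $L$ has the Halldén completeness: for all formulas $\varphi,\psi$ with no variables in common, if $\vdash_L\varphi\vee\psi$ then $\vdash_L\varphi$ or $\vdash_L\psi$. 2. There is an MTL-chain $A$ such that $L$ is complete with respect to $A$, that is, for every formula $\varphi$, $\vdash_L\varphi$ if and only if $\varphi$ is valid in $A$. 3. $L$ is meet irreducible in the lattice of axiomatic extensions of MTL: for all axiomatic extensions $L_1,L_2$ of MTL, if $L=L_1\cap L_2$ then $L=L_1$ or $L=L_2$. -/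

import Mathlib

namespace MTL

/-- Formulas over the primitive connectives `&`, `∧`, `→`, `⊥` and the denumerable set of
variables indexed by `ℕ`. -/
inductive Formula : Type
  | var (n : ℕ) : Formula
  | bot : Formula
  | conj (φ ψ : Formula) : Formula
  | meet (φ ψ : Formula) : Formula
  | imp (φ ψ : Formula) : Formula

namespace Formula

/-- Derived disjunction `((φ → ψ) → ψ) ∧ ((ψ → φ) → φ)`. -/
def disj (φ ψ : Formula) : Formula :=
  meet (imp (imp φ ψ) ψ) (imp (imp ψ φ) φ)

/-- The set of variables occurring in a formula. -/
def vars : Formula → Finset ℕ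
  | var n => {n}
  | bot => ∅
  | conj φ ψ => φ.vars ∪ ψ.vars
  | meet φ ψ => φ.vars ∪ ψ.vars
  | imp φ ψ => φ.vars ∪ ψ.vars

/-- Uniform substitution of formulas for variables. -/
def subst (s : ℕ → Formula) : Formula → Formula
  | var n => s n
  | bot => bot
  | conj φ ψ => conj (φ.subst s) (ψ.subst s)
  | meet φ ψ => meet (φ.subst s) (ψ.subst s)
  | imp φ ψ => imp (φ.subst s) (ψ.subst s)

theorem subst_var (φ : Formula) : φ.subst var = φ := by
  induction φ <;> simp_all [subst]

theorem subst_subst (s t : ℕ → Formula) (φ : Formula) :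
    (φ.subst s).subst t = φ.subst (fun n => (s n).subst t) := by
  induction φ <;> simp_all [subst]

end Formula

open Formula

/-- The axioms (A1)-(A9) of the logic MTL. -/
inductive IsAxiom : Formula → Prop
  | a1 (φ ψ χ : Formula) : IsAxiom (imp (imp φ ψ) (imp (imp ψ χ) (imp φ χ)))
  | a2 (φ ψ : Formula) : IsAxiom (imp (conj φ ψ) φ)
  | a3 (φ ψ : Formula) : IsAxiom (imp (conj φ ψ) (conj ψ φ))
  | a4 (φ ψ : Formula) : IsAxiom (imp (meet φ ψ) φ)
  | a5 (φ ψ : Formula) : IsAxiom (imp (meet φ ψ) (meet ψ φ))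
  | a6 (φ ψ : Formula) : IsAxiom (imp (conj φ (imp φ ψ)) (meet ψ φ))
  | a7a (φ ψ χ : Formula) : IsAxiom (imp (imp φ (imp ψ χ)) (imp (conj φ ψ) χ))
  | a7b (φ ψ χ : Formula) : IsAxiom (imp (imp (conj φ ψ) χ) (imp φ (imp ψ χ)))
  | a8 (φ ψ χ : Formula) :
      IsAxiom (imp (imp (imp φ ψ) χ) (imp (imp (imp ψ φ) χ) χ))
  | a9 (φ : Formula) : IsAxiom (imp bot φ)

theorem IsAxiom.subst {φ : Formula} (h : IsAxiom φ) (s : ℕ → Formula) :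
    IsAxiom (φ.subst s) := by
  cases h <;> simp only [Formula.subst] <;> constructor

/-- `Derivable S φ`: the formula `φ` has a proof by modus ponens from the axioms of MTL together
with the formulas in `S`, taken as additional axiom schemata. -/
inductive Derivable (S : Set Formula) : Formula → Prop
  | mtl {φ : Formula} (h : IsAxiom φ) : Derivable S φ
  | extra {φ : Formula} (h : φ ∈ S) (s : ℕ → Formula) : Derivable S (φ.subst s)
  | mp {φ ψ : Formula} (h₁ : Derivable S φ) (h₂ : Derivable S (imp φ ψ)) : Derivable S ψ

namespace Derivable

theorem of_mem {S : Set Formula} {φ : Formula} (h : φ ∈ S) : Derivable S φ := by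
  simpa [subst_var] using Derivable.extra h Formula.var

theorem subst {S : Set Formula} {φ : Formula} (h : Derivable S φ) (s : ℕ → Formula) :
    Derivable S (φ.subst s) := by
  induction h with
  | mtl h => exact .mtl (h.subst s)
  | extra h t => rw [subst_subst]; exact .extra h _
  | mp _ _ ih₁ ih₂ => exact .mp ih₁ ih₂

/-- A formula derivable from theorems of `T` is a theorem of `T`. -/
theorem trans {S T : Set Formula} (hST : ∀ φ ∈ S, Derivable T φ) {φ : Formula}
    (h : Derivable S φ) : Derivable T φ := by
  induction h with
  | mtl h => exact .mtl h
  | extra h t => exact (hST _ h).subst t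
  | mp _ _ ih₁ ih₂ => exact .mp ih₁ ih₂

end Derivable

/-- An axiomatic extension of MTL, identified with its set of theorems: the set of all formulas
derivable in MTL with some set of additional axiom schemata. -/
@[ext]
structure AxiomaticExtension where
  theorems : Set Formula
  axiomatizable : ∃ S : Set Formula, theorems = {φ | Derivable S φ}

namespace AxiomaticExtension

/-- `L.Proves φ` is `⊢_L φ`. -/
def Proves (L : AxiomaticExtension) (φ : Formula) : Prop := φ ∈ L.theorems

/-- The extension of MTL by the axiom schemata in `S`. -/
def ofAxioms (S : Set Formula) : AxiomaticExtension := ⟨{φ | Derivable S φ}, S, rfl⟩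

theorem mem_of_derivable (L : AxiomaticExtension) {φ : Formula}
    (h : Derivable L.theorems φ) : φ ∈ L.theorems := by
  obtain ⟨T, S, rfl⟩ := L
  exact h.trans fun _ h => h

/-- Axiomatic extensions are ordered by inclusion of their sets of theorems. -/
instance : PartialOrder AxiomaticExtension :=
  PartialOrder.lift theorems fun _ _ h => AxiomaticExtension.ext h

/-- The lattice of axiomatic extensions of MTL: the meet of two logics is the intersection of their
sets of theorems, their join is axiomatized by the union. -/
instance : Lattice AxiomaticExtension where
  inf L M :=
    { theorems := L.theorems ∩ M.theorems
      axiomatizable := ⟨L.theorems ∩ M.theorems, Set.Subset.antisymm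
        (fun _ h => Derivable.of_mem h)
        (fun _ h => ⟨L.mem_of_derivable (h.trans fun _ h => .of_mem h.1),
          M.mem_of_derivable (h.trans fun _ h => .of_mem h.2)⟩)⟩ }
  sup L M := ofAxioms (L.theorems ∪ M.theorems)
  inf_le_left _ _ := fun _ h => h.1
  inf_le_right _ _ := fun _ h => h.2
  le_inf _ _ _ h₁ h₂ := fun _ h => ⟨h₁ h, h₂ h⟩
  le_sup_left _ _ := fun _ h => Derivable.of_mem (Or.inl h)
  le_sup_right _ _ := fun _ h => Derivable.of_mem (Or.inr h)
  sup_le _ _ N h₁ h₂ := fun _ h => N.mem_of_derivable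
    (Derivable.trans (fun _ h => .of_mem (h.elim (fun h => h₁ h) (fun h => h₂ h))) h)

/-- Halldén completeness. -/
def HalldenComplete (L : AxiomaticExtension) : Prop :=
  ∀ φ ψ : Formula, Disjoint φ.vars ψ.vars → L.Proves (disj φ ψ) → L.Proves φ ∨ L.Proves ψ

end AxiomaticExtension

/-- An element of a lattice is meet irreducible if it is not the meet of two elements that are both
different from it. As opposed to `InfIrred`, a greatest element counts as meet irreducible. -/
def MeetIrreducible {α : Type*} [Lattice α] (a : α) : Prop :=
  ∀ b c : α, a = b ⊓ c → a = b ∨ a = c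

/-- FLew-algebras: bounded, integral, commutative residuated lattices. The monoid operation is `*`,
the least and greatest elements are `⊥` and `⊤ = 1`. -/
class FLewAlgebra (A : Type*) extends Lattice A, BoundedOrder A, CommMonoid A where
  /-- The residuum `x ⇒ y`. -/
  res : A → A → A
  one_eq_top : (1 : A) = ⊤
  mul_le_iff_le_res : ∀ x y z : A, z * x ≤ y ↔ z ≤ res x y

/-- MTL-algebras: prelinear FLew-algebras. -/
class MTLAlgebra (A : Type*) extends FLewAlgebra A where
  prelinearity : ∀ x y : A, res x y ⊔ res y x = 1

/-- An MTL-chain is a totally ordered MTL-algebra. -/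
def IsChain (A : Type*) [MTLAlgebra A] : Prop := ∀ x y : A, x ≤ y ∨ y ≤ x

/-- The value of a formula in an algebra under an assignment of the variables. -/
def Formula.eval {A : Type*} [MTLAlgebra A] (v : ℕ → A) : Formula → A
  | var n => v n
  | bot => ⊥
  | conj φ ψ => φ.eval v * ψ.eval v
  | meet φ ψ => φ.eval v ⊓ ψ.eval v
  | imp φ ψ => FLewAlgebra.res (φ.eval v) (ψ.eval v)

/-- `φ` is valid in `A` if every assignment gives it the value `1`. -/
def Valid (A : Type*) [MTLAlgebra A] (φ : Formula) : Prop := ∀ v : ℕ → A, φ.eval v = 1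

/-- `L` is complete with respect to `A`: the theorems of `L` are exactly the formulas valid
in `A`. -/
def CompleteWrt (L : AxiomaticExtension) (A : Type*) [MTLAlgebra A] : Prop :=
  ∀ φ : Formula, L.Proves φ ↔ Valid A φ

end MTL

/-! On a chain a disjunction has value 1 only if a disjunct does. For formulas without common
variables, two refuting assignments merge into one refuting the disjunction, so completeness for a
chain yields Halldén completeness.

Conversely, in a consistent Halldén complete logic, finite disjunctions of nontheorems with
variables renamed apart remain nontheorems. Zorn's lemma gives a theory containing `L`, not
necessarily closed under substitution, maximal among those omitting all of them. Proof by cases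
(`mem_of_mem_adjoin`) makes it linear (`exists_linear_omitting`). Its Lindenbaum algebra is a chain
that validates `L` and refutes each nontheorem at its renamed copy.

Proof by cases also handles meet irreducibility: if `φ ∨ ψ` is a theorem and the variables are
disjoint, then all disjunctions of instances are theorems, so `L` is the meet of its extensions by
`φ` and by `ψ`. In the other direction, nontheorems of `L₁ ⊓ L₂` taken from `L₁` and from `L₂`,
renamed apart, have their disjunction in both logics. -/

namespace MTL

open Formula

universe u

/-! ### Theories -/

/-- A set of formulas that contains the axioms of MTL and is closed under modus ponens. -/
structure Theory where
  carrier : Set Formula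
  ax : ∀ {φ : Formula}, IsAxiom φ → φ ∈ carrier
  mp : ∀ {φ ψ : Formula}, φ ∈ carrier → imp φ ψ ∈ carrier → ψ ∈ carrier

namespace Theory

variable {T : Theory} {φ ψ χ θ : Formula}

theorem imp_trans (h₁ : imp φ ψ ∈ T.carrier) (h₂ : imp ψ χ ∈ T.carrier) :
    imp φ χ ∈ T.carrier :=
  T.mp h₂ (T.mp h₁ (T.ax (.a1 _ _ _)))

theorem curry (h : imp (conj φ ψ) χ ∈ T.carrier) : imp φ (imp ψ χ) ∈ T.carrier :=
  T.mp h (T.ax (.a7b _ _ _))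

theorem uncurry (h : imp φ (imp ψ χ) ∈ T.carrier) : imp (conj φ ψ) χ ∈ T.carrier :=
  T.mp h (T.ax (.a7a _ _ _))

theorem weaken (φ ψ : Formula) : imp φ (imp ψ φ) ∈ T.carrier :=
  curry (T.ax (.a2 _ _))

theorem conj_imp_right (φ ψ : Formula) : imp (conj φ ψ) ψ ∈ T.carrier :=
  imp_trans (T.ax (.a3 _ _)) (T.ax (.a2 _ _))

theorem imp_refl (φ : Formula) : imp φ φ ∈ T.carrier :=
  T.mp (T.ax (.a9 bot)) (curry (conj_imp_right (imp bot bot) φ))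

theorem swap (h : imp φ (imp ψ χ) ∈ T.carrier) : imp ψ (imp φ χ) ∈ T.carrier :=
  curry (imp_trans (T.ax (.a3 _ _)) (uncurry h))

theorem conj_mono_left (h : imp φ ψ ∈ T.carrier) (χ : Formula) :
    imp (conj φ χ) (conj ψ χ) ∈ T.carrier :=
  uncurry (imp_trans h (curry (imp_refl _)))

theorem conj_mono (h₁ : imp φ ψ ∈ T.carrier) (h₂ : imp χ θ ∈ T.carrier) :
    imp (conj φ χ) (conj ψ θ) ∈ T.carrier :=
  imp_trans (conj_mono_left h₁ χ) (imp_trans (T.ax (.a3 _ _))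
    (imp_trans (conj_mono_left h₂ ψ) (T.ax (.a3 _ _))))

theorem conj_assoc_imp (φ ψ χ : Formula) :
    imp (conj (conj φ ψ) χ) (conj φ (conj ψ χ)) ∈ T.carrier :=
  uncurry (uncurry (imp_trans (curry (imp_refl _)) (T.ax (.a7b _ _ _))))

theorem conj_assoc_imp_symm (φ ψ χ : Formula) :
    imp (conj φ (conj ψ χ)) (conj (conj φ ψ) χ) ∈ T.carrier :=
  imp_trans (T.ax (.a3 _ _)) (imp_trans (conj_assoc_imp _ _ _)
    (imp_trans (T.ax (.a3 _ _)) (imp_trans (conj_assoc_imp _ _ _) (T.ax (.a3 _ _)))))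

theorem imp_mono (h₁ : imp ψ φ ∈ T.carrier) (h₂ : imp χ θ ∈ T.carrier) :
    imp (imp φ χ) (imp ψ θ) ∈ T.carrier :=
  imp_trans (T.mp h₁ (T.ax (.a1 _ _ _)))
    (T.mp h₂ (swap (T.ax (.a1 _ _ _))))

/-- Reasoning by cases on `φ → ψ` and `ψ → φ`. -/
theorem prelinear_cases (φ ψ : Formula) (h₁ : imp (imp φ ψ) χ ∈ T.carrier)
    (h₂ : imp (imp ψ φ) χ ∈ T.carrier) : χ ∈ T.carrier :=
  T.mp h₂ (T.mp h₁ (T.ax (.a8 _ _ _)))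

theorem meet_imp_left (φ ψ : Formula) : imp (meet φ ψ) φ ∈ T.carrier :=
  T.ax (.a4 _ _)

theorem meet_imp_right (φ ψ : Formula) : imp (meet φ ψ) ψ ∈ T.carrier :=
  imp_trans (T.ax (.a5 _ _)) (T.ax (.a4 _ _))

theorem imp_meet (h₁ : imp χ φ ∈ T.carrier) (h₂ : imp χ ψ ∈ T.carrier) :
    imp χ (meet φ ψ) ∈ T.carrier :=
  prelinear_cases φ ψ
    (swap (imp_trans h₁ (curry (imp_trans (T.ax (.a6 _ _)) (T.ax (.a5 _ _))))))
    (swap (imp_trans h₂ (curry (T.ax (.a6 _ _)))))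

theorem imp_disj_left (φ ψ : Formula) : imp φ (disj φ ψ) ∈ T.carrier :=
  imp_meet (swap (imp_refl _)) (weaken _ _)

theorem imp_disj_right (φ ψ : Formula) : imp ψ (disj φ ψ) ∈ T.carrier :=
  imp_meet (weaken _ _) (swap (imp_refl _))

/-- Under `φ → ψ` the first conjunct of the disjunction yields `ψ`; under `ψ → φ` the second yields
`φ`. -/
theorem disj_imp (h₁ : imp φ χ ∈ T.carrier) (h₂ : imp ψ χ ∈ T.carrier) :
    imp (disj φ ψ) χ ∈ T.carrier :=
  prelinear_cases φ ψ
    (swap (imp_trans (meet_imp_left _ _) (imp_mono (imp_refl _) h₂)))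
    (swap (imp_trans (meet_imp_right _ _) (imp_mono (imp_refl _) h₁)))

/-! ### The Lindenbaum algebra of a theory -/

/-- Provable equivalence modulo a theory. -/
def setoid (T : Theory) : Setoid Formula where
  r φ ψ := imp φ ψ ∈ T.carrier ∧ imp ψ φ ∈ T.carrier
  iseqv :=
    { refl := fun φ => ⟨imp_refl φ, imp_refl φ⟩
      symm := fun h => ⟨h.2, h.1⟩
      trans := fun h₁ h₂ => ⟨imp_trans h₁.1 h₂.1, imp_trans h₂.2 h₁.2⟩ }

/-- The Lindenbaum algebra of a theory. -/
def Lindenbaum (T : Theory) : Type := Quotient T.setoid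

namespace Lindenbaum

/-- The class of a formula. -/
def of (T : Theory) (φ : Formula) : Lindenbaum T := Quotient.mk T.setoid φ

theorem of_surjective (T : Theory) : Function.Surjective (of T) := Quotient.mk_surjective

theorem ind {p : Lindenbaum T → Prop} (h : ∀ φ, p (of T φ)) (x : Lindenbaum T) : p x :=
  Quotient.ind h x

instance : PartialOrder (Lindenbaum T) where
  le := Quotient.lift₂ (fun φ ψ => imp φ ψ ∈ T.carrier) fun _ _ _ _ h₁ h₂ => propext
    ⟨fun h => imp_trans h₁.2 (imp_trans h h₂.1), fun h => imp_trans h₁.1 (imp_trans h h₂.2)⟩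
  le_refl := ind fun φ => imp_refl φ
  le_trans := ind fun _ => ind fun _ => ind fun _ h₁ h₂ => imp_trans h₁ h₂
  le_antisymm := ind fun _ => ind fun _ h₁ h₂ => Quotient.sound ⟨h₁, h₂⟩

theorem of_le_of : of T φ ≤ of T ψ ↔ imp φ ψ ∈ T.carrier := Iff.rfl

instance : Lattice (Lindenbaum T) where
  inf := Quotient.map₂ meet fun _ _ h₁ _ _ h₂ =>
    ⟨imp_meet (imp_trans (meet_imp_left _ _) h₁.1) (imp_trans (meet_imp_right _ _) h₂.1),
      imp_meet (imp_trans (meet_imp_left _ _) h₁.2) (imp_trans (meet_imp_right _ _) h₂.2)⟩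
  sup := Quotient.map₂ disj fun _ _ h₁ _ _ h₂ =>
    ⟨disj_imp (imp_trans h₁.1 (imp_disj_left _ _)) (imp_trans h₂.1 (imp_disj_right _ _)),
      disj_imp (imp_trans h₁.2 (imp_disj_left _ _)) (imp_trans h₂.2 (imp_disj_right _ _))⟩
  inf_le_left := ind fun _ => ind fun _ => meet_imp_left _ _
  inf_le_right := ind fun _ => ind fun _ => meet_imp_right _ _
  le_inf := ind fun _ => ind fun _ => ind fun _ h₁ h₂ => imp_meet h₁ h₂
  le_sup_left := ind fun _ => ind fun _ => imp_disj_left _ _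
  le_sup_right := ind fun _ => ind fun _ => imp_disj_right _ _
  sup_le := ind fun _ => ind fun _ => ind fun _ h₁ h₂ => disj_imp h₁ h₂

instance : BoundedOrder (Lindenbaum T) where
  top := of T (imp bot bot)
  bot := of T bot
  le_top := ind fun φ => T.mp (imp_refl bot) (weaken (imp bot bot) φ)
  bot_le := ind fun φ => T.ax (.a9 φ)

instance : CommMonoid (Lindenbaum T) where
  mul := Quotient.map₂ conj fun _ _ h₁ _ _ h₂ => ⟨conj_mono h₁.1 h₂.1, conj_mono h₁.2 h₂.2⟩
  one := of T (imp bot bot)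
  mul_assoc := ind fun _ => ind fun _ => ind fun _ =>
    Quotient.sound ⟨conj_assoc_imp _ _ _, conj_assoc_imp_symm _ _ _⟩
  mul_comm := ind fun _ => ind fun _ => Quotient.sound ⟨T.ax (.a3 _ _), T.ax (.a3 _ _)⟩
  one_mul := ind fun _ => Quotient.sound
    ⟨conj_imp_right _ _, T.mp (imp_refl bot) (curry (imp_refl _))⟩
  mul_one := ind fun _ => Quotient.sound
    ⟨T.ax (.a2 _ _), T.mp (imp_refl bot) (swap (curry (imp_refl _)))⟩

theorem of_eq_one : of T φ = 1 ↔ φ ∈ T.carrier :=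
  ⟨fun h => T.mp (imp_refl bot) (of_le_of.1 h.ge),
    fun h => le_antisymm (le_top : of T φ ≤ ⊤) (of_le_of.2 (T.mp h (weaken _ _)))⟩

instance : MTLAlgebra (Lindenbaum T) where
  res := Quotient.map₂ imp fun _ _ h₁ _ _ h₂ => ⟨imp_mono h₁.2 h₂.1, imp_mono h₁.1 h₂.2⟩
  one_eq_top := rfl
  mul_le_iff_le_res := ind fun _ => ind fun _ => ind fun _ => ⟨curry, uncurry⟩
  prelinearity := ind fun _ => ind fun _ => of_eq_one.2
    (prelinear_cases _ _ (imp_disj_left _ _) (imp_disj_right _ _))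

theorem eval_of (s : ℕ → Formula) (φ : Formula) :
    φ.eval (fun n => of T (s n)) = of T (φ.subst s) := by
  induction φ with
  | var n => rfl
  | bot => rfl
  | conj φ ψ ih₁ ih₂ => simp only [Formula.eval, ih₁, ih₂]; rfl
  | meet φ ψ ih₁ ih₂ => simp only [Formula.eval, ih₁, ih₂]; rfl
  | imp φ ψ ih₁ ih₂ => simp only [Formula.eval, ih₁, ih₂]; rfl

/-- Assignments into the Lindenbaum algebra are exactly the classes of substitutions. Since `T` need
not be closed under substitution, validity is stronger than membership. -/
theorem valid_iff : Valid (Lindenbaum T) φ ↔ ∀ s : ℕ → Formula, φ.subst s ∈ T.carrier := by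
  refine ⟨fun h s => of_eq_one.1 (eval_of s φ ▸ h _), fun h v => ?_⟩
  choose s hs using fun n => of_surjective T (v n)
  obtain rfl : (fun n => of T (s n)) = v := funext hs
  rw [eval_of, of_eq_one]
  exact h s

theorem isChain (h : ∀ φ ψ : Formula, imp φ ψ ∈ T.carrier ∨ imp ψ φ ∈ T.carrier) :
    IsChain (Lindenbaum T) :=
  ind fun φ => ind fun ψ => h φ ψ

end Lindenbaum

end Theory

/-! ### MTL-algebras -/

section Algebra

variable {A : Type*} [MTLAlgebra A]

theorem le_unit (x : A) : x ≤ 1 :=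
  FLewAlgebra.one_eq_top (A := A) ▸ le_top

theorem mul_le_mul_of_le_left {x y : A} (h : x ≤ y) (z : A) : x * z ≤ y * z :=
  (FLewAlgebra.mul_le_iff_le_res _ _ _).2
    (h.trans ((FLewAlgebra.mul_le_iff_le_res _ _ _).1 le_rfl))

theorem mul_le_mul_of_le {x y z w : A} (h₁ : x ≤ y) (h₂ : z ≤ w) : x * z ≤ y * w :=
  (mul_le_mul_of_le_left h₁ z).trans
    (by rw [mul_comm y z, mul_comm y w]; exact mul_le_mul_of_le_left h₂ y)

theorem mul_le_right (x y : A) : x * y ≤ y := by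
  simpa using mul_le_mul_of_le_left (le_unit x) y

theorem mul_res_le (x y : A) : x * FLewAlgebra.res x y ≤ y := by
  rw [mul_comm]
  exact (FLewAlgebra.mul_le_iff_le_res _ _ _).2 le_rfl

theorem res_eq_one {x y : A} (h : x ≤ y) : FLewAlgebra.res x y = 1 :=
  le_antisymm (le_unit _) ((FLewAlgebra.mul_le_iff_le_res _ _ _).1 (by rwa [one_mul]))

theorem one_res (y : A) : FLewAlgebra.res 1 y ≤ y := by
  simpa using mul_res_le 1 y

/-- Residuation turns `x ⊔ z = 1` into `y ≤ x * y ⊔ z`; joining with `z` gives the claim. -/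
theorem mul_sup_eq_one {x y z : A} (hx : x ⊔ z = 1) (hy : y ⊔ z = 1) : x * y ⊔ z = 1 := by
  refine le_antisymm (le_unit _) ?_
  have h₁ : x ⊔ z ≤ FLewAlgebra.res y (x * y ⊔ z) := sup_le
    ((FLewAlgebra.mul_le_iff_le_res _ _ _).1 le_sup_left)
    ((FLewAlgebra.mul_le_iff_le_res _ _ _).1
      ((mul_comm z y ▸ mul_le_right y z).trans le_sup_right))
  rw [hx, ← FLewAlgebra.mul_le_iff_le_res, one_mul] at h₁
  exact hy ▸ sup_le h₁ le_sup_right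

theorem closure_sup_eq_one {S : Set A} {z : A} (h : ∀ x ∈ S, x ⊔ z = 1) {p : A}
    (hp : p ∈ Submonoid.closure S) : p ⊔ z = 1 := by
  induction hp using Submonoid.closure_induction with
  | mem x hx => exact h x hx
  | one => exact sup_eq_left.2 (le_unit z)
  | mul x y _ _ ihx ihy => exact mul_sup_eq_one ihx ihy

/-- If every element of `S` joins every element of `S'` to `1`, the filters generated by `S` and
`S'` intersect in `{1}`. -/
theorem eq_one_of_closure_le {S S' : Set A} (h : ∀ x ∈ S, ∀ y ∈ S', x ⊔ y = 1) {p q r : A}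
    (hp : p ∈ Submonoid.closure S) (hq : q ∈ Submonoid.closure S') (hpr : p ≤ r)
    (hqr : q ≤ r) : r = 1 := by
  refine le_antisymm (le_unit _) ?_
  have hpq : p ⊔ q = 1 := closure_sup_eq_one (fun x hx => by
    rw [sup_comm]
    exact closure_sup_eq_one (fun y hy => by rw [sup_comm]; exact h x hx y hy) hq) hp
  exact hpq ▸ sup_le hpr hqr

theorem IsChain.eval_disj (hA : IsChain A) {φ ψ : Formula} {v : ℕ → A}
    (h : (disj φ ψ).eval v = 1) : φ.eval v = 1 ∨ ψ.eval v = 1 := by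
  simp only [disj, Formula.eval] at h
  rcases hA (φ.eval v) (ψ.eval v) with hle | hle
  · rw [res_eq_one hle] at h
    exact .inr (le_antisymm (le_unit _) (h ▸ inf_le_left.trans (one_res _)))
  · rw [res_eq_one hle] at h
    exact .inl (le_antisymm (le_unit _) (h ▸ inf_le_right.trans (one_res _)))

/-- The Lindenbaum algebra lives in `Type`; lifting provides a chain in any universe. -/
instance : MTLAlgebra (ULift.{u} A) where
  res x y := ⟨FLewAlgebra.res x.down y.down⟩
  one_eq_top := congrArg ULift.up FLewAlgebra.one_eq_top
  mul_le_iff_le_res x y z := FLewAlgebra.mul_le_iff_le_res x.down y.down z.down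
  prelinearity x y := congrArg ULift.up (MTLAlgebra.prelinearity x.down y.down)

theorem eval_ulift (v : ℕ → ULift.{u} A) (φ : Formula) :
    (φ.eval v).down = φ.eval fun n => (v n).down := by
  induction φ with
  | var n => rfl
  | bot => rfl
  | conj φ ψ ih₁ ih₂ => simp only [Formula.eval, ← ih₁, ← ih₂]; rfl
  | meet φ ψ ih₁ ih₂ => simp only [Formula.eval, ← ih₁, ← ih₂]; rfl
  | imp φ ψ ih₁ ih₂ => simp only [Formula.eval, ← ih₁, ← ih₂]; rfl

theorem valid_ulift {φ : Formula} : Valid (ULift.{u} A) φ ↔ Valid A φ :=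
  ⟨fun h v => (eval_ulift (fun n => ⟨v n⟩) φ).symm.trans (congrArg ULift.down (h _)),
    fun h v => ULift.down_injective ((eval_ulift v φ).trans (h _))⟩

theorem isChain_ulift (hA : IsChain A) : IsChain (ULift.{u} A) :=
  fun x y => hA x.down y.down

end Algebra

/-! ### Variables and substitution -/

namespace Formula

theorem eval_congr {A : Type*} [MTLAlgebra A] {v w : ℕ → A} {φ : Formula}
    (h : ∀ n ∈ φ.vars, v n = w n) : φ.eval v = φ.eval w := by
  induction φ <;> simp_all [vars, eval]

theorem subst_congr {s t : ℕ → Formula} {φ : Formula}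
    (h : ∀ n ∈ φ.vars, s n = t n) : φ.subst s = φ.subst t := by
  induction φ <;> simp_all [vars, subst]

/-- Renaming of variables. -/
def rename (f : ℕ → ℕ) (φ : Formula) : Formula := φ.subst fun n => var (f n)

theorem vars_rename (f : ℕ → ℕ) (φ : Formula) : (φ.rename f).vars = φ.vars.image f := by
  unfold rename
  induction φ <;> simp_all [vars, subst, Finset.image_union]

theorem rename_leftInverse {f g : ℕ → ℕ} (h : Function.LeftInverse g f) (φ : Formula) :
    (φ.rename f).rename g = φ := by
  simp only [rename, subst_subst, subst, h _, subst_var]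

theorem vars_disj (φ ψ : Formula) : (disj φ ψ).vars = φ.vars ∪ ψ.vars := by
  ext n
  simp only [disj, vars, Finset.mem_union]
  tauto

/-- An injective numbering of the formulas. -/
def code : Formula → ℕ
  | var n => Nat.pair 0 n
  | bot => Nat.pair 1 0
  | conj φ ψ => Nat.pair 2 (Nat.pair φ.code ψ.code)
  | meet φ ψ => Nat.pair 3 (Nat.pair φ.code ψ.code)
  | imp φ ψ => Nat.pair 4 (Nat.pair φ.code ψ.code)

theorem code_injective : Function.Injective code := by
  intro φ
  induction φ with
  | var n => intro ψ h; cases ψ <;> simp_all [code, Nat.pair_eq_pair]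
  | bot => intro ψ h; cases ψ <;> simp_all [code, Nat.pair_eq_pair]
  | conj φ₁ φ₂ ih₁ ih₂ =>
    intro ψ h
    cases ψ <;> simp only [code, Nat.pair_eq_pair] at h <;> try omega
    rw [ih₁ h.2.1, ih₂ h.2.2]
  | meet φ₁ φ₂ ih₁ ih₂ =>
    intro ψ h
    cases ψ <;> simp only [code, Nat.pair_eq_pair] at h <;> try omega
    rw [ih₁ h.2.1, ih₂ h.2.2]
  | imp φ₁ φ₂ ih₁ ih₂ =>
    intro ψ h
    cases ψ <;> simp only [code, Nat.pair_eq_pair] at h <;> try omega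
    rw [ih₁ h.2.1, ih₂ h.2.2]

instance : Countable Formula := code_injective.countable

instance : Nonempty Formula := ⟨bot⟩

end Formula

/-! ### Adjoining formulas to a theory -/

namespace Theory

open Lindenbaum

/-- The theory generated by `T` and a set of formulas. -/
def adjoin (T : Theory) (S : Set Formula) : Theory where
  -- This is the filter generated by the classes of `S`. Products may repeat factors, because `&` is
  -- not idempotent.
  carrier := {χ | ∃ p ∈ Submonoid.closure (of T '' S), p ≤ of T χ}
  ax h := ⟨1, one_mem _, (of_eq_one.2 (T.ax h)).ge⟩
  mp := by
    rintro φ ψ ⟨p, hp, hpφ⟩ ⟨q, hq, hqψ⟩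
    exact ⟨p * q, mul_mem hp hq,
      (mul_le_mul_of_le hpφ hqψ).trans (mul_res_le (of T φ) (of T ψ))⟩

theorem subset_adjoin (T : Theory) (S : Set Formula) : T.carrier ⊆ (T.adjoin S).carrier :=
  fun _ h => ⟨1, one_mem _, (of_eq_one.2 h).ge⟩

theorem mem_adjoin {T : Theory} {S : Set Formula} {φ : Formula} (h : φ ∈ S) :
    φ ∈ (T.adjoin S).carrier :=
  ⟨of T φ, Submonoid.subset_closure ⟨φ, h, rfl⟩, le_rfl⟩

theorem mem_of_mem_adjoin {T : Theory} {S S' : Set Formula}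
    (h : ∀ φ ∈ S, ∀ ψ ∈ S', disj φ ψ ∈ T.carrier) {χ : Formula}
    (h₁ : χ ∈ (T.adjoin S).carrier) (h₂ : χ ∈ (T.adjoin S').carrier) : χ ∈ T.carrier := by
  obtain ⟨p, hp, hpχ⟩ := h₁
  obtain ⟨q, hq, hqχ⟩ := h₂
  refine of_eq_one.1 (eq_one_of_closure_le ?_ hp hq hpχ hqχ)
  rintro _ ⟨φ, hφ, rfl⟩ _ ⟨ψ, hψ, rfl⟩
  exact of_eq_one.2 (h φ hφ ψ hψ)

/-- A theory omitting every member of an increasing sequence of formulas extends to a linear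
theory with the same property. -/
theorem exists_linear_omitting (T : Theory) (E : ℕ → Formula)
    (hmono : ∀ n, imp (E n) (E (n + 1)) ∈ T.carrier) (hE : ∀ n, E n ∉ T.carrier) :
    ∃ M : Theory, T.carrier ⊆ M.carrier ∧ (∀ n, E n ∉ M.carrier) ∧
      ∀ φ ψ : Formula, imp φ ψ ∈ M.carrier ∨ imp ψ φ ∈ M.carrier := by
  obtain ⟨X, hTX, hX⟩ := zorn_subset_nonempty
    {X | ∃ U : Theory, U.carrier = X ∧ T.carrier ⊆ X ∧ ∀ n, E n ∉ X}
    (fun c hc hchain ⟨Y, hY⟩ => by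
      refine ⟨⋃₀ c, ⟨⟨⋃₀ c, fun {φ} h => ?_, fun {φ ψ} h₁ h₂ => ?_⟩, rfl, ?_, ?_⟩,
        fun _ => Set.subset_sUnion_of_mem⟩
      · obtain ⟨U, rfl, -⟩ := hc hY
        exact ⟨_, hY, U.ax h⟩
      · obtain ⟨P, hP, h₁⟩ := h₁
        obtain ⟨Q, hQ, h₂⟩ := h₂
        rcases hchain.total hP hQ with hle | hle
        · obtain ⟨U, rfl, -⟩ := hc hQ
          exact ⟨_, hQ, U.mp (hle h₁) h₂⟩
        · obtain ⟨U, rfl, -⟩ := hc hP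
          exact ⟨_, hP, U.mp h₁ (hle h₂)⟩
      · obtain ⟨U, -, hT, -⟩ := hc hY
        exact hT.trans (Set.subset_sUnion_of_mem hY)
      · rintro n ⟨P, hP, h⟩
        obtain ⟨U, -, -, hU⟩ := hc hP
        exact hU n h)
    T.carrier ⟨T, rfl, subset_rfl, hE⟩
  obtain ⟨⟨M, rfl, -, hM⟩, hmax⟩ := hX
  refine ⟨M, hTX, hM, fun φ ψ => ?_⟩
  have key : ∀ α ∉ M.carrier, ∃ n, E n ∈ (M.adjoin {α}).carrier := by
    intro α hα
    by_contra! h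
    exact hα (hmax ⟨M.adjoin {α}, rfl, hTX.trans (M.subset_adjoin _), h⟩ (M.subset_adjoin _)
      (mem_adjoin rfl))
  have hE' : Monotone fun n => of M (E n) := monotone_nat_of_le_succ fun n => hTX (hmono n)
  -- The sequence increases, so two extensions proving possibly different members both prove the
  -- later one.
  have lift : ∀ {U : Theory}, M.carrier ⊆ U.carrier → ∀ {m n : ℕ}, m ≤ n →
      E m ∈ U.carrier → E n ∈ U.carrier :=
    fun hU _ _ hmn h => Theory.mp _ h (hU (of_le_of.1 (hE' hmn)))
  by_contra! h
  obtain ⟨m, hm⟩ := key _ h.1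
  obtain ⟨n, hn⟩ := key _ h.2
  refine hM (max m n) (mem_of_mem_adjoin ?_ (lift (M.subset_adjoin _) (le_max_left m n) hm)
    (lift (M.subset_adjoin _) (le_max_right m n) hn))
  rintro _ rfl _ rfl
  exact prelinear_cases _ _ (imp_disj_left _ _) (imp_disj_right _ _)

end Theory

/-! ### Axiomatic extensions -/

namespace AxiomaticExtension

variable {L : AxiomaticExtension}

/-- The theorems of an axiomatic extension form a theory. -/
def toTheory (L : AxiomaticExtension) : Theory where
  carrier := L.theorems
  ax h := L.mem_of_derivable (.mtl h)
  mp h₁ h₂ := L.mem_of_derivable (.mp (.of_mem h₁) (.of_mem h₂))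

theorem Proves.subst {φ : Formula} (h : L.Proves φ) (s : ℕ → Formula) :
    L.Proves (φ.subst s) :=
  L.mem_of_derivable (.extra h s)

theorem proves_rename_iff {f : ℕ → ℕ} (hf : Function.Injective f) {φ : Formula} :
    L.Proves (φ.rename f) ↔ L.Proves φ :=
  ⟨fun h => rename_leftInverse (Function.leftInverse_invFun hf) φ ▸ h.subst _,
    fun h => h.subst _⟩

theorem HalldenComplete.of_completeWrt {A : Type*} [MTLAlgebra A] (hA : IsChain A)
    (hL : CompleteWrt L A) : L.HalldenComplete := by
  intro φ ψ hdisj h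
  rw [hL] at h
  simp only [hL _]
  by_contra! hn
  simp only [Valid, not_forall] at hn
  obtain ⟨⟨v, hv⟩, w, hw⟩ := hn
  have hφ := eval_congr (φ := φ) (v := fun n => if n ∈ φ.vars then v n else w n) (w := v)
    fun n hn => if_pos hn
  have hψ := eval_congr (φ := ψ) (v := fun n => if n ∈ φ.vars then v n else w n) (w := w)
    fun n hn => if_neg (Finset.disjoint_right.1 hdisj hn)
  rcases hA.eval_disj (h fun n => if n ∈ φ.vars then v n else w n) with h | h
  · exact hv (hφ ▸ h)
  · exact hw (hψ ▸ h)

theorem HalldenComplete.meetIrreducible (hL : L.HalldenComplete) : MeetIrreducible L := by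
  rintro L₁ L₂ rfl
  by_contra! hne
  have h₁ : ∃ φ, L₁.Proves φ ∧ ¬ (L₁ ⊓ L₂).Proves φ := by
    by_contra! h
    exact hne.1 (le_antisymm inf_le_left h)
  have h₂ : ∃ φ, L₂.Proves φ ∧ ¬ (L₁ ⊓ L₂).Proves φ := by
    by_contra! h
    exact hne.2 (le_antisymm inf_le_right h)
  obtain ⟨φ, hφ, hφ'⟩ := h₁
  obtain ⟨ψ, hψ, hψ'⟩ := h₂
  have hf : Function.Injective fun n : ℕ => 2 * n := fun _ _ h => by simpa using h
  have hg : Function.Injective fun n : ℕ => 2 * n + 1 := fun _ _ h => by simpa using h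
  have hd : Disjoint (φ.rename fun n => 2 * n).vars (ψ.rename fun n => 2 * n + 1).vars := by
    simp only [vars_rename, Finset.disjoint_left, Finset.mem_image]
    rintro _ ⟨m, -, rfl⟩ ⟨n, -, h⟩
    omega
  rcases hL _ _ hd ⟨L₁.toTheory.mp (hφ.subst _) (Theory.imp_disj_left _ _),
    L₂.toTheory.mp (hψ.subst _) (Theory.imp_disj_right _ _)⟩ with h | h
  · exact hφ' ((proves_rename_iff hf).1 h)
  · exact hψ' ((proves_rename_iff hg).1 h)

/-- As `L` is already closed under substitution, a new schema contributes only its own instances. -/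
theorem mem_adjoin_of_derivable {φ χ : Formula} (h : Derivable (L.theorems ∪ {φ}) χ) :
    χ ∈ (L.toTheory.adjoin (Set.range φ.subst)).carrier := by
  induction h with
  | mtl h => exact Theory.ax _ h
  | extra h s =>
    rcases h with h | rfl
    · exact L.toTheory.subset_adjoin _ (Proves.subst h s)
    · exact Theory.mem_adjoin ⟨s, rfl⟩
  | mp _ _ ih₁ ih₂ => exact Theory.mp _ ih₁ ih₂

theorem proves_disj_subst {φ ψ : Formula} (hd : Disjoint φ.vars ψ.vars)
    (h : L.Proves (disj φ ψ)) (s t : ℕ → Formula) :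
    L.Proves (disj (φ.subst s) (ψ.subst t)) := by
  have hφ := subst_congr (φ := φ) (s := fun n => if n ∈ φ.vars then s n else t n) (t := s)
    fun n hn => if_pos hn
  have hψ := subst_congr (φ := ψ) (s := fun n => if n ∈ φ.vars then s n else t n) (t := t)
    fun n hn => if_neg (Finset.disjoint_right.1 hd hn)
  rw [← hφ, ← hψ]
  exact h.subst _

theorem HalldenComplete.of_meetIrreducible (hL : MeetIrreducible L) : L.HalldenComplete := by
  intro φ ψ hd h
  have key : L = ofAxioms (L.theorems ∪ {φ}) ⊓ ofAxioms (L.theorems ∪ {ψ}) := by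
    refine le_antisymm (le_inf (fun _ h => .of_mem (.inl h)) fun _ h => .of_mem (.inl h)) ?_
    rintro χ ⟨h₁, h₂⟩
    refine Theory.mem_of_mem_adjoin (T := L.toTheory) ?_ (mem_adjoin_of_derivable h₁)
      (mem_adjoin_of_derivable h₂)
    rintro _ ⟨s, rfl⟩ _ ⟨t, rfl⟩
    exact proves_disj_subst hd h s t
  refine (hL _ _ key).imp (fun h => ?_) fun h => ?_
  · rw [h]; exact Derivable.of_mem (.inr rfl)
  · rw [h]; exact Derivable.of_mem (.inr rfl)

/-! ### The chain of a Halldén complete logic -/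

open Classical in
/-- The disjunctions of the initial segments of a sequence of formulas, with the theorems of `L`
left out and the variables of distinct members renamed apart. -/
noncomputable def refutables (L : AxiomaticExtension) (χ : ℕ → Formula) : ℕ → Formula
  | 0 => bot
  | n + 1 => disj (refutables L χ n)
      (if L.Proves (χ n) then bot else (χ n).rename (Nat.pair n))

/-- Variables `Nat.pair n m` form block `n`. Only blocks below `n` have been used so far, so the
next disjunct is variable-disjoint from its predecessors. -/
theorem vars_refutables (χ : ℕ → Formula) (n : ℕ) :
    ∀ k ∈ (L.refutables χ n).vars, k.unpair.1 < n := by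
  induction n with
  | zero => simp [refutables, vars]
  | succ n ih =>
    intro k hk
    rw [refutables, vars_disj, Finset.mem_union] at hk
    rcases hk with hk | hk
    · exact (ih k hk).trans n.lt_succ_self
    · split_ifs at hk
      · simp [vars] at hk
      · rw [vars_rename, Finset.mem_image] at hk
        obtain ⟨m, -, rfl⟩ := hk
        simp

theorem pair_injective (n : ℕ) : Function.Injective (Nat.pair n) :=
  fun _ _ h => (Nat.pair_eq_pair.1 h).2

theorem HalldenComplete.not_proves_refutables (hL : L.HalldenComplete) (hbot : ¬ L.Proves bot)
    (χ : ℕ → Formula) (n : ℕ) : ¬ L.Proves (L.refutables χ n) := by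
  induction n with
  | zero => exact hbot
  | succ n ih =>
    intro h
    rw [refutables] at h
    refine (hL _ _ ?_ h).elim ih ?_
    · split_ifs
      · simp [vars]
      · rw [vars_rename, Finset.disjoint_left]
        intro k hk hk'
        obtain ⟨m, -, rfl⟩ := Finset.mem_image.1 hk'
        simpa using vars_refutables χ n _ hk
    · split_ifs with hχ
      · exact hbot
      · exact fun h => hχ ((proves_rename_iff (pair_injective n)).1 h)

/-- A Halldén complete logic extends to a linear theory that refutes an instance of every
non-theorem. -/
theorem HalldenComplete.exists_linear_theory (hL : L.HalldenComplete) :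
    ∃ M : Theory, L.theorems ⊆ M.carrier ∧
      (∀ φ ψ : Formula, imp φ ψ ∈ M.carrier ∨ imp ψ φ ∈ M.carrier) ∧
      ∀ φ : Formula, (∀ s : ℕ → Formula, φ.subst s ∈ M.carrier) → L.Proves φ := by
  -- The sequence starts at `bot`, so the inconsistent logic is treated apart; there `L` itself is a
  -- linear theory.
  by_cases hbot : L.Proves bot
  · have hall : ∀ φ, L.Proves φ := fun φ => L.toTheory.mp hbot (L.toTheory.ax (.a9 φ))
    exact ⟨L.toTheory, subset_rfl, fun _ _ => .inl (hall _), fun φ _ => hall φ⟩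
  · obtain ⟨χ, hχ⟩ := exists_surjective_nat Formula
    obtain ⟨M, hLM, hM, hlin⟩ := L.toTheory.exists_linear_omitting (L.refutables χ)
      (fun n => Theory.imp_disj_left _ _) (hL.not_proves_refutables hbot χ)
    refine ⟨M, hLM, hlin, fun φ hφ => ?_⟩
    obtain ⟨n, rfl⟩ := hχ φ
    by_contra hn
    -- The copy of the nontheorem in block `n` is the last disjunct of member `n + 1`, which `M`
    -- omits.
    refine hM (n + 1) (M.mp (hφ fun k => var (Nat.pair n k)) ?_)
    rw [refutables, if_neg hn]
    exact Theory.imp_disj_right _ _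

theorem HalldenComplete.exists_chain (hL : L.HalldenComplete) :
    ∃ (A : Type u) (_ : MTLAlgebra A), IsChain A ∧ CompleteWrt L A := by
  obtain ⟨M, hLM, hlin, hM⟩ := hL.exists_linear_theory
  refine ⟨ULift.{u} M.Lindenbaum, inferInstance,
    isChain_ulift (Theory.Lindenbaum.isChain hlin), fun φ => ?_⟩
  rw [valid_ulift, Theory.Lindenbaum.valid_iff]
  exact ⟨fun h s => hLM (h.subst s), hM φ⟩

end AxiomaticExtension

end MTL

theorem mainTheorem1 (L : MTL.AxiomaticExtension) :
    List.TFAE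
      [L.HalldenComplete,
       ∃ (A : Type*) (_ : MTL.MTLAlgebra A), MTL.IsChain A ∧ MTL.CompleteWrt L A,
       MTL.MeetIrreducible L] := by
  tfae_have 1 → 2 := fun h => h.exists_chain
  tfae_have 2 → 1 := fun ⟨_, _, hA, hL⟩ => .of_completeWrt hA hL
  tfae_have 1 → 3 := fun h => h.meetIrreducible
  tfae_have 3 → 1 := .of_meetIrreducible
  tfae_finish
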